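/- For an algebraic integer $\alpha$ contained in some cyclotomic field, let $\mathfrak m(\alpha)$ denote the mean (average) of the conjugates over $\mathbb Q$ of the algebraic number $|\alpha|^2$. Let $G$ be a finite group, let $\chi\in\mathrm{Irr}(G)$ be an irreducible complex character of $G$, and let $g\in G$ be an element whose order is a power of a prime $p$. If $p=2$ or $\chi(1)\not\equiv\pm2\pmod p$, then $\chi(g)=0$, or $\chi(g)$ is a root of unity, or $\mathfrak m(\chi(g))\ge 2$. -/

import Mathlib

/-- `Irr(G)`: the characters of the irreducible complex representations of `G`.  Every
finite-dimensional complex representation is isomorphic to one on `ℂⁿ` for some `n`. -/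
def Irr (G : Type*) [Group G] : Set (G → ℂ) :=
  {χ | ∃ (n : ℕ) (ρ : Representation ℂ G (Fin n → ℂ)), ρ.IsIrreducible ∧ χ = ρ.character}

/-- The conjugates over `ℚ` of an algebraic number `β`: the complex roots of its minimal
polynomial over `ℚ` (each of multiplicity one). -/
noncomputable def conjugates (β : ℂ) : Multiset ℂ :=
  (minpoly ℚ β).aroots ℂ

/-- `m(α)`: the mean of the conjugates of `|α|²`.  The mean is a rational number, see
`ofReal_conjMean`, so taking the real part only changes its type. -/
noncomputable def conjMean (α : ℂ) : ℝ :=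
  ((conjugates ((‖α‖ ^ 2 : ℝ) : ℂ)).sum / (conjugates ((‖α‖ ^ 2 : ℝ) : ℂ)).card).re

theorem ofReal_conjMean (α : ℂ) :
    (conjMean α : ℂ) =
      (conjugates ((‖α‖ ^ 2 : ℝ) : ℂ)).sum / (conjugates ((‖α‖ ^ 2 : ℝ) : ℂ)).card := by
  have key : ∀ β : ℂ, ∃ q : ℚ, (conjugates β).sum = (q : ℂ) := by
    intro β
    by_cases hβ : IsIntegral ℚ β
    · refine ⟨-(minpoly ℚ β).nextCoeff, ?_⟩
      have hm := (minpoly.monic hβ).map (algebraMap ℚ ℂ)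
      have h := (IsAlgClosed.splits ((minpoly ℚ β).map (algebraMap ℚ ℂ)))
        |>.nextCoeff_eq_neg_sum_roots_of_monic hm
      rw [Polynomial.nextCoeff_map (algebraMap ℚ ℂ).injective] at h
      have h2 : (conjugates β).sum = -(algebraMap ℚ ℂ (minpoly ℚ β).nextCoeff) := by
        rw [h, neg_neg]; rfl
      rw [h2]; simp
    · exact ⟨0, by simp [conjugates, minpoly.eq_zero hβ]⟩
  obtain ⟨q, hq⟩ := key ((‖α‖ ^ 2 : ℝ) : ℂ)
  unfold conjMean
  rw [hq]
  generalize (conjugates ((‖α‖ ^ 2 : ℝ) : ℂ)).card = c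
  have : ((q : ℂ) / (c : ℂ)) = (((q : ℝ) / (c : ℝ) : ℝ) : ℂ) := by push_cast; rfl
  rw [this, Complex.ofReal_re]

/-! The value α = χ(g) is a sum of χ(1) roots of unity of order dividing pᵐ⁺¹. Sort their
multiplicities into pᵐ rows of length p, a row being a coset of the p-th roots of unity. Averaging
|α|² over the primitive pᵐ⁺¹-th roots turns (p - 1) 𝔪(α) into the sum of the row spreads
(`conjMean_mul_eq_sum_spread`). By `spread_cases`, a nonconstant row has spread at least p - 1, so
𝔪(α) < 2 allows at most one such row. Constant rows contribute 0 to α and multiples of p to χ(1).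
The remaining row thus gives a root of unity, unless its sum, hence χ(1), is ±2 mod p with p odd. -/

open Finset in
/-- Orthogonality of the powers of distinct `N`-th roots of unity. -/
theorem sum_range_mul_inv_pow_eq {F ι : Type*} [Field F] [Fintype ι] {N : ℕ} (hN : N ≠ 0)
    {z : ι → F} (hz : Function.Injective z) (hz1 : ∀ i, z i ^ N = 1) (c : ι → F) :
    ∑ a ∈ range N, (∑ i, c i * z i ^ a) * (∑ i, c i * (z i)⁻¹ ^ a) = N * ∑ i, c i ^ 2 := by
  classical
  have hz0 : ∀ i, z i ≠ 0 := fun i h => by simpa [h, hN] using hz1 i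
  have orth : ∀ i j, ∑ a ∈ range N, (z i * (z j)⁻¹) ^ a = if i = j then (N : F) else 0 := by
    intro i j
    split_ifs with h
    · simp [h, hz0 j]
    · have hne : z i * (z j)⁻¹ - 1 ≠ 0 := by
        rw [sub_ne_zero, ← div_eq_mul_inv, Ne, div_eq_one_iff_eq (hz0 j)]
        exact fun h' => h (hz h')
      have := geom_sum_mul (z i * (z j)⁻¹) N
      rw [mul_pow, inv_pow, hz1, hz1, inv_one, mul_one, sub_self] at this
      exact (mul_eq_zero.1 this).resolve_right hne
  calc ∑ a ∈ range N, (∑ i, c i * z i ^ a) * (∑ i, c i * (z i)⁻¹ ^ a)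
      = ∑ a ∈ range N, ∑ i, ∑ j, c i * c j * (z i * (z j)⁻¹) ^ a := by
        refine sum_congr rfl fun a _ => ?_
        rw [sum_mul_sum]
        refine sum_congr rfl fun i _ => sum_congr rfl fun j _ => ?_
        rw [mul_pow]; ring
    _ = ∑ i, ∑ j, c i * c j * ∑ a ∈ range N, (z i * (z j)⁻¹) ^ a := by
        rw [sum_comm]
        refine sum_congr rfl fun i _ => ?_
        rw [sum_comm]
        exact sum_congr rfl fun j _ => (mul_sum _ _ _).symm
    _ = N * ∑ i, c i ^ 2 := by
        rw [mul_sum]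
        refine sum_congr rfl fun i _ => ?_
        simp only [orth, mul_ite, mul_zero, sum_ite_eq, mem_univ, if_true]
        ring

/-- The sum of the conjugates of `β`, an element of a number field `K`, in terms of the trace. -/
theorem trace_mul_card_conjugates {K : Type*} [Field K] [NumberField K] [Algebra K ℂ] (x : K) :
    (conjugates (algebraMap K ℂ x)).sum / (conjugates (algebraMap K ℂ x)).card *
      Module.finrank ℚ K = ∑ σ : K →ₐ[ℚ] ℂ, σ x := by
  have hx : IsIntegral ℚ x := Algebra.IsIntegral.isIntegral x
  have hmin : minpoly ℚ (algebraMap K ℂ x) = minpoly ℚ x :=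
    minpoly.algebraMap_eq (algebraMap K ℂ).injective x
  have hsplit : ((minpoly ℚ x).map (algebraMap ℚ ℂ)).Splits := IsAlgClosed.splits _
  have hcard : (conjugates (algebraMap K ℂ x)).card = (minpoly ℚ x).natDegree := by
    rw [conjugates, hmin, Polynomial.aroots, ← hsplit.natDegree_eq_card_roots,
      Polynomial.natDegree_map]
  have hdeg : ((minpoly ℚ x).natDegree : ℂ) ≠ 0 := by
    exact_mod_cast (minpoly.natDegree_pos hx).ne'
  rw [← trace_eq_sum_embeddings ℂ (K := ℚ) (L := K) (x := x), trace_eq_sum_roots hsplit, hcard,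
    ← Module.finrank_mul_finrank ℚ (IntermediateField.adjoin ℚ {x}) K,
    IntermediateField.adjoin.finrank hx, conjugates, hmin, nsmul_eq_mul]
  push_cast
  field_simp

/-- The mean of the conjugates of `|α|²` for a cyclotomic `α`, as a sum over roots of unity. -/
theorem conjMean_mul_totient {ι : Type*} [Fintype ι] {N : ℕ} [NeZero N] {ζ : ℂ}
    (hζ : IsPrimitiveRoot ζ N) (c : ι → ℤ) (e : ι → ℕ) :
    (conjMean (∑ i, c i * ζ ^ e i) : ℂ) * N.totient =
      ∑ η ∈ primitiveRoots N ℂ, (∑ i, c i * η ^ e i) * (∑ i, c i * η⁻¹ ^ e i) := by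
  let K := IntermediateField.adjoin ℚ {ζ}
  have hcyc : IsCyclotomicExtension {N} ℚ K :=
    (IntermediateField.isCyclotomicExtension_singleton_iff_eq_adjoin N ℚ ℂ K hζ).2 rfl
  have hnf : NumberField K := IsCyclotomicExtension.numberField {N} ℚ K
  let z : K := IntermediateField.AdjoinSimple.gen ℚ ζ
  have hzζ : algebraMap K ℂ z = ζ := IntermediateField.AdjoinSimple.algebraMap_gen ℚ ζ
  have hz : IsPrimitiveRoot z N :=
    IsPrimitiveRoot.of_map_of_injective (f := algebraMap K ℂ) (by rwa [hzζ])
      (algebraMap K ℂ).injective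
  have hirr : Irreducible (Polynomial.cyclotomic N ℚ) :=
    Polynomial.cyclotomic.irreducible_rat (NeZero.pos N)
  -- Conjugation inverts roots of unity, so |α|² is a polynomial in ζ and ζ⁻¹, which every embedding
  -- of K respects.
  let x : K := (∑ i, c i * z ^ e i) * (∑ i, c i * z⁻¹ ^ e i)
  have hx : algebraMap K ℂ x = ((‖∑ i, c i * ζ ^ e i‖ ^ 2 : ℝ) : ℂ) := by
    have hinv : ζ⁻¹ = (starRingEnd ℂ) ζ :=
      Complex.inv_eq_conj (hζ.norm'_eq_one (NeZero.ne N))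
    rw [Complex.ofReal_pow, ← Complex.mul_conj']
    simp only [x, map_mul, map_sum, map_pow, map_intCast, hzζ, map_inv₀, hinv]
  rw [ofReal_conjMean, ← hx, ← IsCyclotomicExtension.finrank K hirr, trace_mul_card_conjugates,
    ← Finset.sum_coe_sort (primitiveRoots N ℂ)]
  refine Fintype.sum_equiv (hz.embeddingsEquivPrimitiveRoots ℂ hirr) _ _ fun σ => ?_
  simp only [hz.embeddingsEquivPrimitiveRoots_apply_coe, x, map_mul, map_sum, map_pow,
    map_intCast, map_inv₀]

-- By `hpM`, an exponent is prime to M * p as soon as p does not divide it; the other exponents give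
-- the powers of ζ ^ p.
open Finset in
theorem sum_primitiveRoots_mul_prime_eq {p M : ℕ} (hp : p.Prime) (hM : M ≠ 0)
    (hpM : ∀ a : ℕ, a.Coprime p → a.Coprime M) {F A : Type*} [Field F] [AddCommGroup A] {ζ : F}
    (hζ : IsPrimitiveRoot ζ (M * p)) (f : F → A) :
    ∑ η ∈ primitiveRoots (M * p) F, f η =
      ∑ a ∈ range (M * p), f (ζ ^ a) - ∑ b ∈ range M, f ((ζ ^ p) ^ b) := by
  have hN : 0 < M * p := Nat.mul_pos (Nat.pos_of_ne_zero hM) hp.pos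
  have : NeZero (M * p) := ⟨hN.ne'⟩
  have h1 : ∑ η ∈ primitiveRoots (M * p) F, f η =
      ∑ a ∈ (range (M * p)).filter (fun a => ¬ p ∣ a), f (ζ ^ a) := by
    symm
    refine sum_bij (fun a _ => ζ ^ a) ?_ ?_ ?_ (fun _ _ => rfl)
    · intro a ha
      rw [mem_filter, mem_range] at ha
      have hap : a.Coprime p := ((Nat.Prime.coprime_iff_not_dvd hp).2 ha.2).symm
      exact (mem_primitiveRoots hN).2
        (hζ.pow_of_coprime a (Nat.Coprime.mul_right (hpM a hap) hap))
    · intro a ha b hb hab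
      rw [mem_filter, mem_range] at ha hb
      exact hζ.pow_inj ha.1 hb.1 hab
    · intro η hη
      obtain ⟨i, hi, hc, rfl⟩ := hζ.isPrimitiveRoot_iff.1 ((mem_primitiveRoots hN).1 hη)
      refine ⟨i, ?_, rfl⟩
      rw [mem_filter, mem_range]
      exact ⟨hi, (Nat.Prime.coprime_iff_not_dvd hp).1 (Nat.Coprime.coprime_mul_left_right hc).symm⟩
  have h2 : ∑ b ∈ range M, f ((ζ ^ p) ^ b) =
      ∑ a ∈ (range (M * p)).filter (fun a => p ∣ a), f (ζ ^ a) := by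
    refine sum_bij (fun b _ => p * b) ?_ ?_ ?_ ?_
    · intro b hb
      rw [mem_range] at hb
      rw [mem_filter, mem_range, mul_comm M]
      exact ⟨Nat.mul_lt_mul_of_pos_left hb hp.pos, dvd_mul_right _ _⟩
    · intro a _ b _ hab
      exact Nat.eq_of_mul_eq_mul_left hp.pos hab
    · intro a ha
      rw [mem_filter, mem_range] at ha
      obtain ⟨h, b, rfl⟩ := ha
      rw [mul_comm M] at h
      exact ⟨b, mem_range.2 (Nat.lt_of_mul_lt_mul_left h), rfl⟩
    · intro b _
      rw [pow_mul]
  rw [h1, h2, eq_sub_iff_add_eq, add_comm]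
  exact sum_filter_add_sum_filter_not _ _ _

/-! ### Spread of an integer vector -/

/-- `p ∑ bₖ² - (∑ bₖ)²`, which is the sum of `(bₖ - bₗ)²` over the pairs `k < l`. -/
def spread {p : ℕ} (b : Fin p → ℤ) : ℤ := p * ∑ k, b k ^ 2 - (∑ k, b k) ^ 2

open Finset in
theorem spread_add_const {p : ℕ} (b : Fin p → ℤ) (t : ℤ) :
    spread (fun k => b k + t) = spread b := by
  simp only [spread, add_sq, sum_add_distrib, sum_const, card_univ, Fintype.card_fin,
    nsmul_eq_mul, ← sum_mul, ← mul_sum]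
  ring

open Finset in
theorem exists_eq_single_of_sum_sq_eq_one {ι : Type*} [Fintype ι] [DecidableEq ι] (b : ι → ℤ)
    (h : ∑ k, b k ^ 2 = 1) : ∃ k₀, ∃ u : ℤ, (u = 1 ∨ u = -1) ∧ b = Pi.single k₀ u := by
  have : ∃ k, b k ≠ 0 := by
    by_contra! h0
    simp [h0] at h
  obtain ⟨k₀, hk₀⟩ := this
  have hpos : 1 ≤ b k₀ ^ 2 := Int.add_one_le_iff.2 (sq_pos_of_ne_zero hk₀)
  have hsplit := add_sum_erase univ (fun k => b k ^ 2) (mem_univ k₀)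
  have hrest : 0 ≤ ∑ k ∈ univ.erase k₀, b k ^ 2 := sum_nonneg fun _ _ => sq_nonneg _
  refine ⟨k₀, b k₀, sq_eq_one_iff.1 (by linarith), ?_⟩
  have hzero : ∑ k ∈ univ.erase k₀, b k ^ 2 = 0 := by linarith
  rw [sum_eq_zero_iff_of_nonneg fun _ _ => sq_nonneg _] at hzero
  ext k
  by_cases hk : k = k₀
  · subst hk; simp
  · simpa [hk] using hzero k (by simp [hk])

-- Subtracting a constant t leaves the spread alone and brings the sum to c with 2|c| ≤ p. With q
-- the sum of squares, the spread is pq - c², where q ≥ |c| and q ≡ c mod 2. Only |c| = 2, where the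
-- bound is 2p - 4, can escape both the single-entry case and 2(p - 1).
open Finset in
theorem spread_cases {p : ℕ} (hp : p.Prime) (b : Fin p → ℤ) :
    (∃ t, ∀ k, b k = t) ∨
    ((p : ℤ) - 1 ≤ spread b ∧ ((∃ t k₀, ∃ u : ℤ, (u = 1 ∨ u = -1) ∧
        ∀ k, b k = t + Pi.single (M := fun _ => ℤ) k₀ u k) ∨
      2 * ((p : ℤ) - 1) ≤ spread b ∨
      (p ≠ 2 ∧ (∑ k, b k ≡ 2 [ZMOD p] ∨ ∑ k, b k ≡ -2 [ZMOD p])))) := by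
  have hp2 : (2 : ℤ) ≤ p := by exact_mod_cast hp.two_le
  obtain ⟨t, c, hc, hc1, hc2⟩ : ∃ t c : ℤ, ∑ k, b k = p * t + c ∧ 2 * c ≤ p ∧ -p ≤ 2 * c := by
    rcases le_or_gt (2 * ((∑ k, b k) % p)) p with h | h
    · refine ⟨(∑ k, b k) / p, (∑ k, b k) % p, (Int.mul_ediv_add_emod _ _).symm, h, ?_⟩
      have := Int.emod_nonneg (∑ k, b k) (b := (p : ℤ)) (by omega)
      omega
    · refine ⟨(∑ k, b k) / p + 1, (∑ k, b k) % p - p, ?_, ?_, ?_⟩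
      · have := Int.mul_ediv_add_emod (∑ k, b k) p
        linarith
      · have := Int.emod_lt_of_pos (∑ k, b k) (b := (p : ℤ)) (by omega)
        omega
      · omega
  let d : Fin p → ℤ := fun k => b k + -t
  have hbd : ∀ k, b k = t + d k := fun k => by simp [d]
  have hdsum : ∑ k, d k = c := by simp [d, sum_add_distrib, hc]
  have hspread : spread b = p * ∑ k, d k ^ 2 - c ^ 2 := by
    rw [← spread_add_const b (-t), spread, hdsum]
  have hq0 : 0 ≤ ∑ k, d k ^ 2 := sum_nonneg fun _ _ => sq_nonneg _
  have habs : |c| ≤ ∑ k, d k ^ 2 := by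
    rw [← hdsum]
    refine (abs_sum_le_sum_abs _ _).trans (sum_le_sum fun k _ => ?_)
    rw [← sq_abs]
    exact Int.le_self_sq |d k|
  -- Parity excludes q = 1 for c = 0 and q = 2 for |c| = 1.
  have hpar : ∃ m, ∑ k, d k ^ 2 = c + 2 * m := by
    have : (2 : ℤ) ∣ ∑ k, (d k ^ 2 - d k) := dvd_sum fun k _ => by
      have := Int.even_mul_pred_self (d k)
      rw [show d k ^ 2 - d k = d k * (d k - 1) by ring]
      exact this.two_dvd
    obtain ⟨m, hm⟩ := this
    rw [sum_sub_distrib, hdsum] at hm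
    exact ⟨m, by linarith⟩
  obtain ⟨m, hm⟩ := hpar
  have hcsq : c ^ 2 = |c| ^ 2 := (sq_abs c).symm
  have hcp : 2 * |c| ≤ p := by rcases abs_cases c with h | h <;> omega
  set q := ∑ k, d k ^ 2 with hq
  have hlow : (p : ℤ) * |c| - |c| ^ 2 ≤ spread b := by
    rw [hspread, hcsq]; nlinarith
  have hge3 : ∀ {x : ℤ}, x ≤ q → (p : ℤ) * x - c ^ 2 ≤ spread b := by
    intro x hx; rw [hspread]; nlinarith
  rcases lt_or_ge |c| 3 with hlt | hge
  · have hcs : c = 0 ∨ (c = 1 ∨ c = -1) ∨ (c = 2 ∨ c = -2) := by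
      rcases abs_cases c with h | h <;> omega
    rcases hcs with rfl | hc1 | hc2
    · by_cases hq0' : q = 0
      · left
        rw [hq, sum_eq_zero_iff_of_nonneg fun _ _ => sq_nonneg _] at hq0'
        exact ⟨t, fun k => by rw [hbd, pow_eq_zero_iff two_ne_zero |>.1 (hq0' k (mem_univ k))]; simp⟩
      · right
        have := hge3 (x := 2) (by omega)
        exact ⟨by linarith, Or.inr (Or.inl (by linarith))⟩
    · right
      have hcc : c ^ 2 = 1 := by rcases hc1 with h | h <;> simp [h]
      by_cases hq1 : q = 1
      · obtain ⟨k₀, u, hu, hd⟩ := exists_eq_single_of_sum_sq_eq_one d hq1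
        refine ⟨by rw [hspread, hq1, hcc]; linarith, Or.inl ⟨t, k₀, u, hu, fun k => ?_⟩⟩
        rw [hbd, hd]
      · have := hge3 (x := 3) (by rcases abs_cases c with h | h <;> omega)
        exact ⟨by linarith, Or.inr (Or.inl (by linarith))⟩
    · right
      have hcc : |c| = 2 := by rcases hc2 with h | h <;> simp [h]
      rw [hcc] at hlow hcp
      refine ⟨by linarith, Or.inr (Or.inr ⟨by rintro rfl; norm_num at hcp, ?_⟩)⟩
      rw [hc]
      have hmod : ∀ x : ℤ, p * t + x ≡ x [ZMOD p] := fun x => by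
        simp [Int.ModEq]
      rcases hc2 with h | h <;> subst h
      · exact Or.inl (hmod _)
      · exact Or.inr (hmod _)
  · right
    -- For |c| = 3 the bound 3p - 9 ≥ 2(p - 1) needs p ≥ 7, while 2|c| ≤ p gives only p ≥ 6.
    have hp6 : (p : ℤ) ≠ 6 := by
      intro h
      have : p = 6 := by exact_mod_cast h
      subst this; revert hp; decide
    have hkey : 2 * ((p : ℤ) - 1) ≤ spread b := by
      refine le_trans ?_ hlow
      rcases hge.eq_or_lt with h | h
      · rw [← h] at hcp ⊢; omega
      · nlinarith
    exact ⟨by linarith, Or.inr (Or.inl hkey)⟩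

/-! ### Traces as sums of roots of unity, and their means -/

theorem exists_multiset_trace_eq {n N : ℕ} (f : Module.End ℂ (Fin n → ℂ)) (hf : f ^ N = 1) :
    ∃ s : Multiset ℂ, s.card = n ∧ s.sum = LinearMap.trace ℂ _ f ∧ ∀ x ∈ s, x ^ N = 1 := by
  have hs := IsAlgClosed.splits f.charpoly
  refine ⟨f.charpoly.roots, ?_, ?_, ?_⟩
  · rw [← hs.natDegree_eq_card_roots, LinearMap.charpoly_natDegree, Module.finrank_fin_fun]
  · exact (Module.End.trace_eq_sum_roots_charpoly_of_splits hs).symm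
  · intro x hx
    have hev : f.HasEigenvalue x := (Module.End.hasEigenvalue_iff_isRoot_charpoly f x).2
      (Polynomial.isRoot_of_mem_roots hx)
    obtain ⟨v, hv⟩ := hev.exists_hasEigenvector
    have h := hv.pow_apply N
    rw [hf, Module.End.one_apply] at h
    have h' : (x ^ N - 1) • v = 0 := by rw [sub_smul, one_smul, ← h, sub_self]
    exact sub_eq_zero.1 ((smul_eq_zero.1 h').resolve_right hv.2)

open Finset in
theorem exists_multiplicities {M p : ℕ} (hM : 0 < M) (hp : 0 < p) {ζ : ℂ}
    (hζ : IsPrimitiveRoot ζ (M * p)) (s : Multiset ℂ) (hs : ∀ x ∈ s, x ^ (M * p) = 1) :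
    ∃ a : Fin M → Fin p → ℤ, ∑ r, ∑ k, a r k = s.card ∧
      s.sum = ∑ r, ∑ k, (a r k : ℂ) * ζ ^ ((r : ℕ) + M * k) := by
  have : NeZero (M * p) := ⟨(Nat.mul_pos hM hp).ne'⟩
  induction s using Multiset.induction_on with
  | empty => exact ⟨0, by simp, by simp⟩
  | cons x s ih =>
    obtain ⟨a, h1, h2⟩ := ih fun y hy => hs y (Multiset.mem_cons_of_mem hy)
    obtain ⟨i, hi, rfl⟩ := hζ.eq_pow_of_pow_eq_one (hs x (Multiset.mem_cons_self x s))
    let r₀ : Fin M := ⟨i % M, Nat.mod_lt _ hM⟩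
    let k₀ : Fin p := ⟨i / M, Nat.div_lt_of_lt_mul hi⟩
    have hi' : (r₀ : ℕ) + M * k₀ = i := Nat.mod_add_div i M
    refine ⟨fun r k => a r k + if r = r₀ then (if k = k₀ then 1 else 0) else 0, ?_, ?_⟩
    · simp only [sum_add_distrib, h1, Multiset.card_cons, Nat.cast_add, Nat.cast_one]
      rw [Fintype.sum_eq_single r₀ (by intro r hr; simp [hr])]
      simp
    · simp only [Int.cast_add, add_mul, sum_add_distrib, Multiset.sum_cons, h2]
      rw [add_comm, add_right_inj, Fintype.sum_eq_single r₀ (by intro r hr; simp [hr]),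
        Fintype.sum_eq_single k₀ (by intro k hk; simp [hk])]
      simp [hi']

-- The sum over primitive roots is the sum over all pᵐ⁺¹-th roots minus that over the pᵐ-th roots.
-- Orthogonality gives squares of entries in the first and squares of row sums in the second; the
-- factor pᵐ of the totient cancels.
open Finset in
theorem conjMean_mul_eq_sum_spread {p m : ℕ} (hp : p.Prime) {ζ : ℂ}
    (hζ : IsPrimitiveRoot ζ (p ^ m * p)) (a : Fin (p ^ m) → Fin p → ℤ) :
    conjMean (∑ r, ∑ k, (a r k : ℂ) * ζ ^ ((r : ℕ) + p ^ m * k)) * (p - 1) =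
      ∑ r, spread (a r) := by
  have hM : p ^ m ≠ 0 := pow_ne_zero _ hp.ne_zero
  have hN : p ^ m * p ≠ 0 := mul_ne_zero hM hp.ne_zero
  have : NeZero (p ^ m * p) := ⟨hN⟩
  have hmean := conjMean_mul_totient hζ (fun x : Fin (p ^ m) × Fin p => a x.1 x.2)
    (fun x => (x.1 : ℕ) + p ^ m * x.2)
  rw [sum_primitiveRoots_mul_prime_eq hp hM (fun _ h => h.pow_right m) hζ] at hmean
  have hfull : ∑ j ∈ range (p ^ m * p),
      (∑ x : Fin (p ^ m) × Fin p, (a x.1 x.2 : ℂ) * (ζ ^ j) ^ ((x.1 : ℕ) + p ^ m * x.2)) *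
        (∑ x : Fin (p ^ m) × Fin p, (a x.1 x.2 : ℂ) * (ζ ^ j)⁻¹ ^ ((x.1 : ℕ) + p ^ m * x.2)) =
      (p ^ m * p : ℕ) * ∑ x : Fin (p ^ m) × Fin p, (a x.1 x.2 : ℂ) ^ 2 := by
    rw [← sum_range_mul_inv_pow_eq hN
      (z := fun x : Fin (p ^ m) × Fin p => ζ ^ ((x.1 : ℕ) + p ^ m * x.2))]
    · simp only [← inv_pow, ← pow_mul, mul_comm]
    · rintro ⟨r, k⟩ ⟨r', k'⟩ h
      have hlt : ∀ (r : Fin (p ^ m)) (k : Fin p), (r : ℕ) + p ^ m * k < p ^ m * p := fun r k =>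
        calc (r : ℕ) + p ^ m * k < p ^ m + p ^ m * k := by have := r.2; omega
          _ = p ^ m * (k + 1) := by ring
          _ ≤ p ^ m * p := Nat.mul_le_mul_left _ k.2
      have h' := hζ.pow_inj (hlt r k) (hlt r' k') h
      have hr : (r : ℕ) = r' := by
        have := congrArg (· % p ^ m) h'
        simpa [Nat.add_mul_mod_self_left, Nat.mod_eq_of_lt r.2, Nat.mod_eq_of_lt r'.2] using this
      rw [hr, add_right_inj] at h'
      exact Prod.ext (Fin.ext hr) (Fin.ext (Nat.eq_of_mul_eq_mul_left (Nat.pos_of_ne_zero hM) h'))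
    · intro x
      rw [← pow_mul, mul_comm, pow_mul, hζ.pow_eq_one, one_pow]
  have hζp : IsPrimitiveRoot (ζ ^ p) (p ^ m) := hζ.pow (Nat.pos_of_ne_zero hN) (mul_comm _ _)
  have hsub : ∑ j ∈ range (p ^ m),
      (∑ x : Fin (p ^ m) × Fin p, (a x.1 x.2 : ℂ) * ((ζ ^ p) ^ j) ^ ((x.1 : ℕ) + p ^ m * x.2)) *
        (∑ x : Fin (p ^ m) × Fin p,
          (a x.1 x.2 : ℂ) * ((ζ ^ p) ^ j)⁻¹ ^ ((x.1 : ℕ) + p ^ m * x.2)) =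
      (p ^ m : ℕ) * ∑ r, (∑ k, (a r k : ℂ)) ^ 2 := by
    rw [← sum_range_mul_inv_pow_eq hM (z := fun r : Fin (p ^ m) => (ζ ^ p) ^ (r : ℕ))
      (fun r r' h => Fin.ext (hζp.pow_inj r.2 r'.2 h))
      (fun r => by rw [← pow_mul, mul_comm, pow_mul, hζp.pow_eq_one, one_pow])]
    refine sum_congr rfl fun j _ => ?_
    -- A pᵐ-th root of unity does not see k, so each row collapses to its sum.
    have hred : ∀ w : ℂ, w ^ p ^ m = 1 →
        ∑ x : Fin (p ^ m) × Fin p, (a x.1 x.2 : ℂ) * (w ^ j) ^ ((x.1 : ℕ) + p ^ m * x.2) =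
          ∑ r : Fin (p ^ m), (∑ k, (a r k : ℂ)) * (w ^ (r : ℕ)) ^ j := by
      intro w hw
      rw [Fintype.sum_prod_type]
      refine sum_congr rfl fun r _ => ?_
      rw [sum_mul]
      refine sum_congr rfl fun k _ => ?_
      rw [← pow_mul, mul_comm j, pow_mul, pow_add, pow_mul w, hw, one_pow, mul_one]
    have hinv : ((ζ ^ p)⁻¹) ^ p ^ m = 1 := by rw [inv_pow, hζp.pow_eq_one, inv_one]
    simp only [← inv_pow (ζ ^ p)]
    rw [hred _ hζp.pow_eq_one, hred _ hinv]
  rw [hfull, hsub, Fintype.sum_prod_type, Fintype.sum_prod_type, ← pow_succ,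
    Nat.totient_prime_pow_succ hp] at hmean
  have hMC : ((p ^ m : ℕ) : ℂ) ≠ 0 := by exact_mod_cast hM
  have hfin : (conjMean (∑ r, ∑ k, (a r k : ℂ) * ζ ^ ((r : ℕ) + p ^ m * k)) : ℂ) * (p - 1) =
      ((∑ r, spread (a r) : ℤ) : ℂ) := by
    refine mul_left_cancel₀ hMC ?_
    rw [Nat.cast_mul, Nat.cast_sub hp.one_le] at hmean
    simp only [spread, sum_sub_distrib, ← mul_sum]
    push_cast at hmean ⊢
    linear_combination hmean
  exact_mod_cast hfin

open Finset in
/-- A sum of `pᵐ⁺¹`-th roots of unity whose mean is less than `2`. -/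
theorem eq_zero_or_root_of_unity_or_two_le_conjMean {p m : ℕ} (hp : p.Prime) {ζ : ℂ}
    (hζ : IsPrimitiveRoot ζ (p ^ m * p)) (a : Fin (p ^ m) → Fin p → ℤ)
    (h : p = 2 ∨ (¬ ∑ r, ∑ k, a r k ≡ 2 [ZMOD p] ∧ ¬ ∑ r, ∑ k, a r k ≡ -2 [ZMOD p])) {α : ℂ}
    (hα : α = ∑ r, ∑ k, (a r k : ℂ) * ζ ^ ((r : ℕ) + p ^ m * k)) :
    α = 0 ∨ (∃ k : ℕ, 0 < k ∧ α ^ k = 1) ∨ 2 ≤ conjMean α := by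
  have hM : p ^ m ≠ 0 := pow_ne_zero _ hp.ne_zero
  have hN : p ^ m * p ≠ 0 := mul_ne_zero hM hp.ne_zero
  have hp2 : (2 : ℤ) ≤ p := by exact_mod_cast hp.two_le
  rw [or_iff_not_imp_right, not_or, not_le]
  rintro ⟨hroot, hlt⟩
  have hmean : ∑ r, spread (a r) < 2 * ((p : ℤ) - 1) := by
    have := conjMean_mul_eq_sum_spread hp hζ a
    rw [← hα] at this
    have hp1 : (0 : ℝ) < p - 1 := by
      have : (2 : ℝ) ≤ p := by exact_mod_cast hp.two_le
      linarith
    have h2 : ((∑ r, spread (a r) : ℤ) : ℝ) < ((2 * ((p : ℤ) - 1) : ℤ) : ℝ) := by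
      rw [← this]; push_cast; nlinarith
    exact_mod_cast h2
  have hrow : ∀ (r : Fin (p ^ m)) (t : ℤ), ∑ k : Fin p, (t : ℂ) * ζ ^ ((r : ℕ) + p ^ m * k) = 0 := by
    intro r t
    have hζM : IsPrimitiveRoot (ζ ^ p ^ m) p := hζ.pow (Nat.pos_of_ne_zero hN) rfl
    simp only [pow_add, pow_mul, ← mul_sum]
    rw [Fin.sum_univ_eq_sum_range (fun k => (ζ ^ p ^ m) ^ k), hζM.geom_sum_eq_zero hp.one_lt]
    simp
  have hconst : ∀ r t, (∀ k, a r k = t) →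
      ∑ k : Fin p, (a r k : ℂ) * ζ ^ ((r : ℕ) + p ^ m * k) = 0 := by
    intro r t ht
    simp only [ht, hrow]
  have hnonneg : ∀ r, 0 ≤ spread (a r) := by
    intro r
    rcases spread_cases hp (a r) with ⟨t, ht⟩ | ⟨hge, -⟩
    · rw [spread]
      simp only [ht, sum_const, card_univ, Fintype.card_fin, nsmul_eq_mul]
      exact le_of_eq (by ring)
    · linarith
  by_cases hall : ∀ r, ∃ t, ∀ k, a r k = t
  · rw [hα]
    exact sum_eq_zero fun r _ => (hall r).elim (hconst r)
  push Not at hall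
  obtain ⟨r₀, hr₀⟩ := hall
  have hothers : ∀ r, r ≠ r₀ → ∃ t, ∀ k, a r k = t := by
    intro r hr
    rcases spread_cases hp (a r) with ht | ⟨hge, -⟩
    · exact ht
    · rcases spread_cases hp (a r₀) with ⟨t, ht⟩ | ⟨hge₀, -⟩
      · obtain ⟨k, hk⟩ := hr₀ t
        exact absurd (ht k) hk
      -- Two nonconstant rows would already contribute 2(p - 1).
      · have := sum_le_sum_of_subset_of_nonneg (subset_univ {r, r₀})
          (fun i _ _ => hnonneg i) (f := fun r => spread (a r))
        rw [sum_pair hr] at this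
        linarith
  rcases spread_cases hp (a r₀) with ⟨t, ht⟩ | ⟨-, ⟨t, k₀, u, hu, hk⟩ | hge | ⟨hpne, hmod⟩⟩
  · obtain ⟨k, hk⟩ := hr₀ t
    exact absurd (ht k) hk
  -- The factor 2 absorbs the sign u.
  · refine absurd ⟨p ^ m * p * 2, Nat.pos_of_ne_zero (mul_ne_zero hN two_ne_zero), ?_⟩ hroot
    have : α = u * ζ ^ ((r₀ : ℕ) + p ^ m * k₀) := by
      rw [hα, Fintype.sum_eq_single r₀ fun r hr => (hothers r hr).elim (hconst r)]
      simp only [hk, Int.cast_add, add_mul, sum_add_distrib, hrow, zero_add]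
      rw [Fintype.sum_eq_single k₀ (by intro k hk; simp [hk])]
      simp
    have hu2 : (u : ℂ) ^ 2 = 1 := by rcases hu with rfl | rfl <;> simp
    rw [this, mul_pow, mul_comm (p ^ m * p) 2, pow_mul (u : ℂ), hu2, one_pow, one_mul, ← pow_mul,
      mul_comm 2, mul_left_comm, pow_mul, hζ.pow_eq_one, one_pow]
  · have := single_le_sum (fun r _ => hnonneg r) (mem_univ r₀)
    linarith
  · have htot : ∑ r, ∑ k, a r k ≡ ∑ k, a r₀ k [ZMOD p] := by
      rw [← add_sum_erase univ (fun r => ∑ k, a r k) (mem_univ r₀), Int.modEq_iff_dvd,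
        ← dvd_neg]
      simp only [neg_sub, add_sub_cancel_left]
      refine dvd_sum fun r hr => ?_
      obtain ⟨t, ht⟩ := hothers r (ne_of_mem_erase hr)
      simp [ht]
    obtain ⟨h1, h2⟩ := h.resolve_left hpne
    rcases hmod with h' | h'
    · exact absurd (htot.trans h') h1
    · exact absurd (htot.trans h') h2

theorem theorem4 (G : Type*) [Group G] [Finite G] (χ : G → ℂ) (hχ : χ ∈ Irr G)
    (p : ℕ) (hp : p.Prime) (g : G) (hg : ∃ n : ℕ, orderOf g = p ^ n)
    (h : p = 2 ∨ ∀ d : ℤ, χ 1 = (d : ℂ) → ¬ d ≡ 2 [ZMOD p] ∧ ¬ d ≡ -2 [ZMOD p]) :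
    χ g = 0 ∨ (∃ k : ℕ, 0 < k ∧ χ g ^ k = 1) ∨ 2 ≤ conjMean (χ g) := by
  obtain ⟨n, ρ, -, rfl⟩ := hχ
  obtain ⟨m, hm⟩ := hg
  have hM : 0 < p ^ m := pow_pos hp.pos _
  have hN : p ^ m * p ≠ 0 := (Nat.mul_pos hM hp.pos).ne'
  -- The extra factor p makes the rows have length p even when g = 1.
  have hpow : ρ g ^ (p ^ m * p) = 1 := by
    rw [← map_pow, pow_mul, ← hm, pow_orderOf_eq_one, one_pow, map_one]
  obtain ⟨s, hcard, hsum, hs⟩ := exists_multiset_trace_eq (ρ g) hpow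
  have hζ := Complex.isPrimitiveRoot_exp (p ^ m * p) hN
  obtain ⟨a, ha, hα⟩ := exists_multiplicities hM hp.pos hζ s hs
  refine eq_zero_or_root_of_unity_or_two_le_conjMean hp hζ a (h.imp_right fun h => ?_)
    (hsum.symm.trans hα)
  rw [ha, hcard]
  exact h n (by rw [Representation.char_one, Module.finrank_fin_fun, Int.cast_natCast])
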